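/- **Setting and notation.** Let $G=(V,E)$ be a finite simple graph with $n=|V|$ vertices and edge weights $w_e\ge 0$, let $k\ge 2$ be a real number, and let $\log$ be the logarithm to base $2$. A *cluster* $c$ is a set $V_c$ of vertices together with a rooted tree $T_c$ in $G$ with vertex set $V_c$; its *radius* is the depth of $T_c$ (in number of edges). A *clustering* is a set of pairwise disjoint clusters. For a set of edges $\mathsf E$, let $\mathsf E(c,c')$ be the set of edges in $\mathsf E$ with one endpoint in $c$ and the other in $c'$ (similarly $\mathsf E(v,c)$ for a vertex $v$); $c,c'$ are *neighbors* if $\mathsf E(c,c')\neq\emptyset$. A clustering $\mathcal C$ has *weighted-stretch radius* at most $r$ with respect to $\mathsf E$ if every $c\in\mathcal C$ has radius at most $r$, and for every $e\in\mathsf E$ and every endpoint $x$ of $e$ that lies in a cluster $c\in\mathcal C$, all edges on the path in $T_c$ from $x$ to the root have weight at most $w_e$. A subgraph $H$ of $G$ on the vertex set $V$ is a *spanner of stretch* $t$ if $d_H(u,v)\le t\cdot d_G(u,v)$ for all $u,v\in V$, where $d$ denotes weighted distance. **The cluster-merging algorithm.** Start with $\mathcal C^{(0)}$ = all single vertices,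 $\mathsf E=\mathsf E^{(0)}=E$, and spanner edges $E_S=\emptyset$. *Phase 1.* For $i=1,\dots,\lceil\log k\rceil$, epoch $i$ does the following. 1. Sample $\mathcal R^{(i)}\subseteq\mathcal C^{(i-1)}$, including each cluster independently with probability $n^{-2^{i-1}/k}$. 2. For each unsampled $c\in\mathcal C^{(i-1)}\setminus\mathcal R^{(i)}$ with a neighbor in $\mathcal R^{(i)}$, let $\mathcal N(c)$ be a closest neighbor of $c$ in $\mathcal R^{(i)}$ and $e_c$ a lowest weight edge in $\mathsf E(c,\mathcal N(c))$. Add $e_c$ to $E_S$ and discard $\mathsf E(c,\mathcal N(c))$ from $\mathsf E$. For every $c'\in\mathcal C^{(i-1)}$ such that $\mathsf E(c,c')$ contains an edge of weight strictly less than that of $e_c$, add a lowest weight edge of $\mathsf E(c,c')$ to $E_S$ and discard $\mathsf E(c,c')$ from $\mathsf E$. 3. For each unsampled $c$ without a neighbor in $\mathcal R^{(i)}$ and each neighbor $c'\in\mathcal C^{(i-1)}$ of $c$, add a lowest weight edge of $\mathsf E(c,c')$ to $E_S$ and discard $\mathsf E(c,c')$ from $\mathsf E$. 4. Let $\mathcal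 C^{(i)}$ consist of the sampled clusters $c$, each keeping its root and absorbing all unsampled $\bar c$ with $\mathcal N(\bar c)=c$, the tree of $\bar c$ being attached by the edge $e_{\bar c}$. 5. Remove from $\mathsf E$ all edges with both endpoints in the same cluster of $\mathcal C^{(i)}$; call the result $\mathsf E^{(i)}$. *Phase 2.* For each vertex $v$ and each cluster $c$ of the last clustering with $\mathsf E(v,c)\ne\emptyset$, add a lowest weight edge of $\mathsf E(v,c)$ to $E_S$. Output $E_S$. In each step, all clusters (or pairs) are treated simultaneously, with respect to the set $\mathsf E$ at the beginning of the epoch (in Phase 2, at the end of Phase 1). Ties are broken by an arbitrary fixed rule. **Theorem.** There is an absolute constant $C>0$ such that for all $G$, $w$, $k\ge 2$ and all tie-breaking rules: * the number of epochs is at most $C\log k$; * for every outcome of the sampling and every $0\le i\le\lceil\log k\rceil$, after epoch $i$ the set $\mathcal C^{(i)}$ is a clustering of weighted-stretch radius at most $\frac{3^i-1}{2}$ with respect to $\mathsf E^{(i)}$; * for every outcome of the sampling, $E_S\subseteq E$ and $(V,E_S)$ is a spanner of $G$ of stretch at most $C\,k^{\log 3}$; * $\mathbb E\,|E_S|\le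 C\,n^{1+1/k}\log k$. -/

import Mathlib

open scoped NNReal ENNReal

namespace ClusterMerging

noncomputable section

/-- Length of the walk `p` with respect to the edge weights `w`. -/
def walkWeight {V : Type*} (w : Sym2 V → ℝ≥0) {H : SimpleGraph V} {u v : V}
    (p : H.Walk u v) : ℝ≥0 :=
  (p.edges.map w).sum

/-- Weighted distance in the graph `H`; it is `⊤` between different components. -/
def wdist {V : Type*} (H : SimpleGraph V) (w : Sym2 V → ℝ≥0) (u v : V) : ℝ≥0∞ :=
  ⨅ p : H.Walk u v, (walkWeight w p : ℝ≥0∞)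

/-- `H` is a spanner of `(G, w)` of stretch `t`: a subgraph of `G` on the same vertex set in which
all distances are at most `t` times the distances in `G`. -/
def IsSpanner {V : Type*} (G : SimpleGraph V) (w : Sym2 V → ℝ≥0) (H : SimpleGraph V)
    (t : ℝ≥0∞) : Prop :=
  H ≤ G ∧ ∀ u v : V, wdist H w u v ≤ t * wdist G w u v

/-- A cluster: a set of vertices, a root (the center) and the edges of a rooted tree.
That the edges do form a tree on `verts` is `Cluster.IsRootedTree`. -/
@[ext]
structure Cluster (V : Type*) where
  verts : Finset V
  root : V
  edges : Finset (Sym2 V)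

namespace Cluster

variable {V : Type*}

/-- The tree of the cluster, as a graph on `V` (with all vertices outside `verts` isolated). -/
def tree (c : Cluster V) : SimpleGraph V := SimpleGraph.fromEdgeSet (c.edges : Set (Sym2 V))

/-- `c.edges` are edges of `G` that form a tree with vertex set `c.verts`, which contains
`c.root`. -/
structure IsRootedTree (G : SimpleGraph V) (c : Cluster V) : Prop where
  root_mem : c.root ∈ c.verts
  edges_subset : ∀ e ∈ c.edges, e ∈ G.edgeSet
  edges_inside : ∀ e ∈ c.edges, ∀ x ∈ e, x ∈ c.verts
  acyclic : c.tree.IsAcyclic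
  connected : ∀ x ∈ c.verts, c.tree.Reachable x c.root

/-- The radius of a cluster: the depth of its tree, measured from the root in number of edges. -/
def radius (c : Cluster V) : ℕ := c.verts.sup fun x => c.tree.dist x c.root

end Cluster

section Definitions

variable {V : Type*}

/-- `𝒞` is a clustering in `G`: pairwise disjoint clusters, each with a rooted tree in `G`. -/
structure IsClustering (G : SimpleGraph V) (𝒞 : Finset (Cluster V)) : Prop where
  rootedTree : ∀ c ∈ 𝒞, c.IsRootedTree G
  disjoint : ∀ c ∈ 𝒞, ∀ c' ∈ 𝒞, c ≠ c' → Disjoint c.verts c'.verts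

/-- `𝒞` is a clustering of weighted-stretch radius (at most) `r` with respect to the edge set `E`:
every cluster has radius at most `r`, and for every edge `e ∈ E` and every endpoint `x` of `e`
lying in a cluster `c ∈ 𝒞`, all edges on the path from `x` to the root in the tree of `c` have
weight at most the weight of `e`. -/
structure HasWeightedStretchRadius (G : SimpleGraph V) (w : Sym2 V → ℝ≥0)
    (𝒞 : Finset (Cluster V)) (E : Finset (Sym2 V)) (r : ℝ) : Prop where
  isClustering : IsClustering G 𝒞
  radius_le : ∀ c ∈ 𝒞, (c.radius : ℝ) ≤ r
  weight_le : ∀ e ∈ E, ∀ c ∈ 𝒞, ∀ x ∈ c.verts, x ∈ e →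
    ∀ p : c.tree.Walk x c.root, p.IsPath → ∀ f ∈ p.edges, w f ≤ w e

open scoped Classical in
/-- `E(c₁, c₂)`: the edges in `E` with one endpoint in `c₁` and the other one in `c₂`. -/
def edgesBetween (E : Finset (Sym2 V)) (c₁ c₂ : Cluster V) : Finset (Sym2 V) :=
  E.filter fun e => ∃ x ∈ c₁.verts, ∃ y ∈ c₂.verts, e = s(x, y)

open scoped Classical in
/-- `E(v, c)`: the edges in `E` between the vertex `v` and the cluster `c`. -/
def edgesFrom (E : Finset (Sym2 V)) (v : V) (c : Cluster V) : Finset (Sym2 V) :=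
  E.filter fun e => ∃ y ∈ c.verts, e = s(v, y)

/-- `c` and `c'` are neighbors: some edge of `E` joins them. -/
def Neighbors (E : Finset (Sym2 V)) (c c' : Cluster V) : Prop := (edgesBetween E c c').Nonempty

/-- A choice, with ties broken arbitrarily, of a lowest weight edge in every nonempty set of edges,
and of a closest neighboring sampled cluster `closest E R c` of every cluster `c` that has a
neighbor in the set `R` of sampled clusters, when `E` is the set of unprocessed edges. -/
structure Choice (w : Sym2 V → ℝ≥0) where
  lowest : Finset (Sym2 V) → Sym2 V
  lowest_mem : ∀ F : Finset (Sym2 V), F.Nonempty → lowest F ∈ F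
  lowest_le : ∀ F : Finset (Sym2 V), ∀ f ∈ F, w (lowest F) ≤ w f
  closest : Finset (Sym2 V) → Finset (Cluster V) → Cluster V → Cluster V
  closest_mem : ∀ E R c, (∃ r ∈ R, Neighbors E c r) → closest E R c ∈ R
  closest_neighbors : ∀ E R c, (∃ r ∈ R, Neighbors E c r) → Neighbors E c (closest E R c)
  closest_le : ∀ E R c, ∀ r ∈ R, ∀ f ∈ edgesBetween E c r,
    ∃ e ∈ edgesBetween E c (closest E R c), w e ≤ w f

/-- Such choices exist, for all weights. -/
theorem Choice.nonempty [Nonempty V] (w : Sym2 V → ℝ≥0) : Nonempty (Choice w) := by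
  classical
  obtain ⟨v⟩ := ‹Nonempty V›
  have h₁ : ∀ F : Finset (Sym2 V), ∃ e, (F.Nonempty → e ∈ F) ∧ ∀ f ∈ F, w e ≤ w f := by
    intro F
    rcases F.eq_empty_or_nonempty with rfl | hF
    · exact ⟨s(v, v), by simp⟩
    · obtain ⟨e, he, h⟩ := F.exists_min_image w hF
      exact ⟨e, fun _ => he, h⟩
  choose low hlow using h₁
  have h₂ : ∀ (E : Finset (Sym2 V)) (R : Finset (Cluster V)) (c : Cluster V), ∃ d : Cluster V,
      (∃ r ∈ R, Neighbors E c r) → d ∈ R ∧ Neighbors E c d ∧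
        ∀ r ∈ R, ∀ f ∈ edgesBetween E c r, ∃ e ∈ edgesBetween E c d, w e ≤ w f := by
    intro E R c
    by_cases h : ∃ r ∈ R, Neighbors E c r
    · obtain ⟨r₀, hr₀, hn₀⟩ := h
      obtain ⟨d, hd, hmin⟩ := (R.filter fun r => Neighbors E c r).exists_min_image
        (fun r => w (low (edgesBetween E c r))) ⟨r₀, Finset.mem_filter.mpr ⟨hr₀, hn₀⟩⟩
      rw [Finset.mem_filter] at hd
      refine ⟨d, fun _ => ⟨hd.1, hd.2, fun r hr f hf => ?_⟩⟩
      exact ⟨_, (hlow _).1 hd.2,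
        (hmin r (Finset.mem_filter.mpr ⟨hr, ⟨f, hf⟩⟩)).trans ((hlow _).2 f hf)⟩
    · exact ⟨⟨∅, v, ∅⟩, fun h' => absurd h' h⟩
  choose clo hclo using h₂
  exact ⟨⟨low, fun F => (hlow F).1, fun F => (hlow F).2, clo,
    fun E R c h => (hclo E R c h).1, fun E R c h => (hclo E R c h).2.1,
    fun E R c r hr f hf => (hclo E R c ⟨r, hr, ⟨f, hf⟩⟩).2.2 r hr f hf⟩⟩

/-- The state of the algorithm between two epochs: the current clusters, the set of unprocessed
edges and the set of spanner edges found so far. -/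
@[ext]
structure State (V : Type*) where
  clusters : Finset (Cluster V)
  unprocessed : Finset (Sym2 V)
  spanner : Finset (Sym2 V)

open scoped Classical in
/-- At the start every vertex is a cluster, all edges of `G` are unprocessed, and the spanner
is empty. -/
def State.init [Fintype V] (G : SimpleGraph V) : State V where
  clusters := Finset.univ.image fun v => ⟨{v}, v, ∅⟩
  unprocessed := Finset.univ.filter fun e => e ∈ G.edgeSet
  spanner := ∅

/-- The unsampled cluster `c` has a neighbor in the set `R` of sampled clusters. -/
def HasSampledNeighbor (s : State V) (R : Finset (Cluster V)) (c : Cluster V) : Prop :=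
  ∃ r ∈ R, Neighbors s.unprocessed c r

variable {w : Sym2 V → ℝ≥0}

/-- The edge along which an unsampled cluster `c` is merged to its closest neighboring sampled
cluster. -/
def mergeEdge (ch : Choice w) (s : State V) (R : Finset (Cluster V)) (c : Cluster V) : Sym2 V :=
  ch.lowest (edgesBetween s.unprocessed c (ch.closest s.unprocessed R c))

/-- Whether the edges between the unsampled cluster `c` and the cluster `c'` are processed (the
lowest weight one is added to the spanner and all of them are removed from the unprocessed edges)
when `c` is considered. If `c` has a sampled neighbor, this happens for the closest one, and for
all clusters adjacent to `c` via an edge of weight strictly less than that of the merge edge.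
Otherwise it happens for all neighbors of `c`. -/
def Processes (ch : Choice w) (s : State V) (R : Finset (Cluster V)) (c c' : Cluster V) : Prop :=
  (HasSampledNeighbor s R c ∧
    (c' = ch.closest s.unprocessed R c ∨
      ∃ f ∈ edgesBetween s.unprocessed c c', w f < w (mergeEdge ch s R c))) ∨
  (¬ HasSampledNeighbor s R c ∧ Neighbors s.unprocessed c c')

open scoped Classical in
/-- The pairs `(c, c')` with `c` unsampled such that the edges between `c` and `c'` are processed
when `c` is considered. -/
def processedPairs (ch : Choice w) (s : State V) (R : Finset (Cluster V)) :
    Finset (Cluster V × Cluster V) :=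
  ((s.clusters \ R) ×ˢ s.clusters).filter fun q => Processes ch s R q.1 q.2

open scoped Classical in
/-- The unsampled clusters that are absorbed by the sampled cluster `c`. -/
def absorbed (ch : Choice w) (s : State V) (R : Finset (Cluster V)) (c : Cluster V) :
    Finset (Cluster V) :=
  (s.clusters \ R).filter fun b =>
    HasSampledNeighbor s R b ∧ ch.closest s.unprocessed R b = c

open scoped Classical in
/-- The new cluster grown from the sampled cluster `c`: it keeps the root of `c`, and the trees
of all absorbed clusters are attached to the tree of `c` by their merge edges. -/
def grow (ch : Choice w) (s : State V) (R : Finset (Cluster V)) (c : Cluster V) : Cluster V where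
  verts := c.verts ∪ (absorbed ch s R c).biUnion Cluster.verts
  root := c.root
  edges := c.edges ∪
    (absorbed ch s R c).biUnion fun b => insert (mergeEdge ch s R b) b.edges

open scoped Classical in
/-- One epoch, when `R ⊆ s.clusters` is the set of sampled clusters. At the end, the edges inside
one of the new clusters are removed from the unprocessed edges. -/
def State.step (ch : Choice w) (s : State V) (R : Finset (Cluster V)) : State V where
  clusters := R.image (grow ch s R)
  unprocessed :=
    (s.unprocessed \ (processedPairs ch s R).biUnion fun q =>
      edgesBetween s.unprocessed q.1 q.2).filter
        fun e => ¬ ∃ c ∈ R.image (grow ch s R), ∀ x ∈ e, x ∈ c.verts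
  spanner := s.spanner ∪ (processedPairs ch s R).image fun q =>
    ch.lowest (edgesBetween s.unprocessed q.1 q.2)

open scoped Classical in
/-- The second phase, and the output of the algorithm: for every vertex `v` and every final cluster
`c` with unprocessed edges between them, a lowest weight one of these is added to the spanner. -/
def State.output [Fintype V] (ch : Choice w) (s : State V) : Finset (Sym2 V) :=
  s.spanner ∪
    (((Finset.univ : Finset V) ×ˢ s.clusters).filter fun q =>
      (edgesFrom s.unprocessed q.1 q.2).Nonempty).image fun q =>
        ch.lowest (edgesFrom s.unprocessed q.1 q.2)

open scoped Classical in
theorem sum_sampleWeight {α : Type*} (p : ℝ≥0) (hp : p ≤ 1) (S : Finset α) :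
    ∑ R ∈ S.powerset,
      (if R ⊆ S then (p : ℝ≥0∞) ^ R.card * (1 - (p : ℝ≥0∞)) ^ (S \ R).card else 0) = 1 := by
  have h : ∀ R ∈ S.powerset,
      (if R ⊆ S then (p : ℝ≥0∞) ^ R.card * (1 - (p : ℝ≥0∞)) ^ (S \ R).card else 0) =
        (p : ℝ≥0∞) ^ R.card * (1 - (p : ℝ≥0∞)) ^ (S.card - R.card) := by
    intro R hR
    rw [Finset.mem_powerset] at hR
    rw [if_pos hR, Finset.card_sdiff_of_subset hR]
  rw [Finset.sum_congr rfl h, Finset.sum_pow_mul_eq_add_pow, add_tsub_cancel_of_le, one_pow]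
  exact_mod_cast hp

open scoped Classical in
/-- A random subset `R` of the finite set `S` that contains every element of `S` independently
with probability `p`. -/
def sample {α : Type*} (p : ℝ≥0) (hp : p ≤ 1) (S : Finset α) : PMF (Finset α) :=
  PMF.ofFinset
    (fun R => if R ⊆ S then (p : ℝ≥0∞) ^ R.card * (1 - (p : ℝ≥0∞)) ^ (S \ R).card else 0)
    S.powerset (sum_sampleWeight p hp S)
    (fun _ hR => if_neg fun h => hR (Finset.mem_powerset.mpr h))

/-- The sampling probability `n ^ (-2 ^ (i - 1) / k)` of epoch `i ≥ 1`. -/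
def samplingProb (n : ℕ) (k : ℝ≥0) (i : ℕ) : ℝ≥0 :=
  (n : ℝ≥0) ^ (-((2 : ℝ) ^ (i - 1) / (k : ℝ)))

theorem samplingProb_le_one (n : ℕ) (k : ℝ≥0) (i : ℕ) : samplingProb n k i ≤ 1 := by
  have hx : (0 : ℝ) ≤ (2 : ℝ) ^ (i - 1) / (k : ℝ) := by positivity
  unfold samplingProb
  rcases Nat.eq_zero_or_pos n with rfl | hn
  · rcases hx.eq_or_lt with h | h
    · simp [← h]
    · rw [Nat.cast_zero, NNReal.zero_rpow (by linarith)]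
      exact zero_le_one
  · exact NNReal.rpow_le_one_of_one_le_of_nonpos (by exact_mod_cast hn) (by linarith)

/-- The state of the algorithm after `i` epochs of the first phase. -/
def phaseOne [Fintype V] (G : SimpleGraph V) (ch : Choice w) (k : ℝ≥0) : ℕ → PMF (State V)
  | 0 => PMF.pure (State.init G)
  | i + 1 => (phaseOne G ch k i).bind fun s =>
      (sample (samplingProb (Fintype.card V) k (i + 1))
        (samplingProb_le_one _ _ _) s.clusters).map fun R => s.step ch R

/-- The number `⌈log₂ k⌉` of epochs. -/
def numEpochs (k : ℝ≥0) : ℕ := ⌈Real.logb 2 k⌉₊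

/-- The cluster-merging algorithm: `numEpochs k` epochs of the first phase, followed by the second
phase. Its result is the random set of spanner edges. -/
def clusterMerging [Fintype V] (G : SimpleGraph V) (ch : Choice w) (k : ℝ≥0) :
    PMF (Finset (Sym2 V)) :=
  (phaseOne G ch k (numEpochs k)).map fun s => s.output ch

/-- The expected size of a random finite set. -/
def expectedCard {α : Type*} (P : PMF (Finset α)) : ℝ≥0∞ := ∑' F, P F * (F.card : ℝ≥0∞)

end Definitions

end

end ClusterMerging

/-! The deterministic claims come from `Invariant`, which every epoch preserves for every sample
(`Invariant.step`). Its core: from an endpoint `x` of an unprocessed edge `e`, the tree leads to the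
root over edges no heavier than `e`. Let `b` be absorbed by `c` along its merge edge `m`. From `x`
in `b`, the new root is reached via the root of `b`, down to `m`, across it, and up to the root of
`c`. This takes `3r + 1` hops, whence the radius `(3^i - 1)/2`. The first leg is light for `e` by
the invariant, the rest is no heavier than `m`, and `m` is no heavier than a surviving `e`, because
anything strictly lighter at `b` was discarded.

A discarded edge between two clusters is replaced by a detour through both roots and the chosen
lowest edge (`4r + 1` hops), an edge inside a new cluster by a detour through its root (`2(3r + 1)`
hops). All these walks use edges no heavier than the one replaced, so hop bounds are stretch bounds,
and the number of epochs turns `2 * 3^i` into `O(k^(log 3))`.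

For the size, order the neighbors of a cluster by their lightest connecting edge. Apart from the
closest sampled neighbor, the `j`-th one is processed only if none of the first `j` is sampled, so
the expected number of processed neighbors is at most the geometric sum `1/p`
(`expect_card_processed_le`). The expected number of clusters after `i` epochs is at most `n^(1 -
(2^i - 1)/k)`; multiplied by `1/p = n^(2^i/k)` this is `n^(1 + 1/k)` in every epoch. Phase 2 costs
at most `n` times the number of final clusters, which `2^⌈log k⌉ ≥ k` bounds in the same way. -/

namespace ClusterMerging

variable {V : Type*}

/-! ### Short walks with light edges, and how they give spanners -/

/-- There is a walk of length at most `n` from `x` to `y` in `H` all of whose edges satisfy `P`. -/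
def Within (H : SimpleGraph V) (P : Sym2 V → Prop) (n : ℕ) (x y : V) : Prop :=
  ∃ p : H.Walk x y, p.length ≤ n ∧ ∀ e ∈ p.edges, P e

namespace Within

variable {H H' : SimpleGraph V} {P Q : Sym2 V → Prop} {m n : ℕ} {x y z : V}

theorem refl (H : SimpleGraph V) (P : Sym2 V → Prop) (n : ℕ) (x : V) : Within H P n x x :=
  ⟨.nil, by simp, by simp⟩

theorem symm (h : Within H P n x y) : Within H P n y x := by
  obtain ⟨p, hp, hP⟩ := h
  exact ⟨p.reverse, by simpa using hp, by simpa using hP⟩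

theorem trans (h : Within H P m x y) (h' : Within H P n y z) : Within H P (m + n) x z := by
  obtain ⟨p, hp, hP⟩ := h
  obtain ⟨q, hq, hQ⟩ := h'
  refine ⟨p.append q, by rw [SimpleGraph.Walk.length_append]; omega, fun e he => ?_⟩
  rw [SimpleGraph.Walk.edges_append, List.mem_append] at he
  exact he.elim (hP e) (hQ e)

theorem of_adj (h : H.Adj x y) (hP : P s(x, y)) : Within H P 1 x y :=
  ⟨h.toWalk, by simp, by simpa using hP⟩

theorem mono (h : Within H P m x y) (hH : H ≤ H') (hP : ∀ e, P e → Q e) (hmn : m ≤ n) :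
    Within H' Q n x y := by
  obtain ⟨p, hp, hp'⟩ := h
  refine ⟨p.mapLe hH, by rw [SimpleGraph.Walk.length_mapLe]; omega, fun e he => ?_⟩
  rw [SimpleGraph.Walk.edges_mapLe_eq_edges] at he
  exact hP e (hp' e he)

/-- Paths in an acyclic graph are unique, so the path is the `bypass` of any given walk. The
invariant can therefore speak of walks, which concatenate freely, although the radius condition
speaks of paths. -/
theorem forall_path_edges (h : Within H P n x y) (hH : H.IsAcyclic) (p : H.Walk x y)
    (hp : p.IsPath) : ∀ e ∈ p.edges, P e := by
  classical
  obtain ⟨q, -, hq⟩ := h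
  have : p = q.bypass :=
    congrArg Subtype.val ((hH.subsingleton_path x y).elim ⟨p, hp⟩ ⟨q.bypass, q.bypass_isPath⟩)
  intro e he
  rw [this] at he
  exact hq e (q.edges_bypass_subset_edges he)

theorem dist_le (h : Within H P n x y) : H.dist x y ≤ n := by
  obtain ⟨p, hp, -⟩ := h
  exact (SimpleGraph.dist_le p).trans hp

theorem reachable (h : Within H P n x y) : H.Reachable x y := ⟨h.choose⟩

theorem wdist_le {w : Sym2 V → ℝ≥0} {b : ℝ≥0} (h : Within H (fun e => w e ≤ b) n x y) :
    wdist H w x y ≤ n * b := by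
  obtain ⟨p, hp, hP⟩ := h
  refine (iInf_le _ p).trans ?_
  have h1 : walkWeight w p ≤ p.length * b := by
    unfold walkWeight
    have := List.sum_le_card_nsmul (p.edges.map w) b (by simpa using hP)
    simpa using this
  calc (walkWeight w p : ℝ≥0∞) ≤ ((p.length * b : ℝ≥0) : ℝ≥0∞) := by exact_mod_cast h1
    _ ≤ n * b := by
      push_cast
      gcongr

end Within

theorem wdist_self (H : SimpleGraph V) (w : Sym2 V → ℝ≥0) (x : V) : wdist H w x x = 0 := by
  refine le_antisymm ((iInf_le _ SimpleGraph.Walk.nil).trans ?_) zero_le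
  simp [walkWeight]

theorem wdist_triangle (H : SimpleGraph V) (w : Sym2 V → ℝ≥0) (x y z : V) :
    wdist H w x z ≤ wdist H w x y + wdist H w y z := by
  refine ENNReal.le_iInf_add_iInf fun p q => (iInf_le _ (p.append q)).trans ?_
  simp [walkWeight]

/-- A subgraph is a spanner as soon as it contains a walk with few and light edges between the
endpoints of every edge. -/
theorem isSpanner_of_within {G H : SimpleGraph V} {w : Sym2 V → ℝ≥0} {n : ℕ} {t : ℝ≥0∞}
    (hH : H ≤ G) (hn : (n : ℝ≥0∞) ≤ t) (ht₀ : t ≠ 0) (ht : t ≠ ⊤)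
    (h : ∀ x y, G.Adj x y → Within H (fun e => w e ≤ w s(x, y)) n x y) : IsSpanner G w H t := by
  refine ⟨hH, fun u v => ?_⟩
  conv_rhs => unfold wdist
  -- With `t` inside the infimum, it suffices to replace a single walk edge by edge.
  rw [ENNReal.mul_iInf_of_ne ht₀ ht]
  refine le_iInf fun p => ?_
  induction p with
  | nil => simp [wdist_self]
  | @cons x y z hxy p ih =>
    refine (wdist_triangle H w x y z).trans ?_
    have h1 : walkWeight w (p.cons hxy) = w s(x, y) + walkWeight w p := by
      simp [walkWeight]
    rw [h1, ENNReal.coe_add, mul_add]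
    gcongr
    exact (h x y hxy).wdist_le.trans (by gcongr)

/-! ### Gluing trees along single edges -/

section Acyclic

variable {A B : SimpleGraph V} {S : Set V}

/-- A walk in `S` can only take `A`-edges, and these end in `S` again. -/
theorem walk_sup_mem_left (hA : ∀ x y, A.Adj x y → y ∈ S) (hB : ∀ x y, B.Adj x y → x ∉ S)
    {u v : V} (p : (A ⊔ B).Walk u v) (hu : u ∈ S) : v ∈ S ∧ ∀ e ∈ p.edges, e ∈ A.edgeSet := by
  induction p with
  | nil => simpa using hu
  | @cons x y z hxy p ih =>
    have h : A.Adj x y := hxy.resolve_right fun h => hB _ _ h hu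
    obtain ⟨h1, h2⟩ := ih (hA _ _ h)
    refine ⟨h1, fun e he => ?_⟩
    rw [SimpleGraph.Walk.edges_cons, List.mem_cons] at he
    rcases he with rfl | he
    · exact h
    · exact h2 e he

theorem isAcyclic_sup_of_disjoint (hA : A.IsAcyclic) (hB : B.IsAcyclic)
    (hAS : ∀ x y, A.Adj x y → x ∈ S) (hBS : ∀ x y, B.Adj x y → x ∉ S) : (A ⊔ B).IsAcyclic := by
  intro v p hp
  by_cases hv : v ∈ S
  · have h := (walk_sup_mem_left (fun x y h => hAS y x h.symm) hBS p hv).2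
    exact hA _ (hp.transfer h)
  -- A cycle based outside `S` is the same situation with `A` and `B` exchanged and `S`
  -- complemented.
  · have key : ∀ q : (B ⊔ A).Walk v v, ¬ q.IsCycle := fun q hq =>
      hB _ (hq.transfer (walk_sup_mem_left (S := Sᶜ) (fun x y h => hBS y x h.symm)
        (fun x y h h' => h' (hAS x y h)) q hv).2)
    exact key _ (hp.mapLe (sup_comm A B).le)

theorem isAcyclic_sup_edge (hA : A.IsAcyclic) (hB : B.IsAcyclic)
    (hAS : ∀ x y, A.Adj x y → x ∈ S) (hBS : ∀ x y, B.Adj x y → x ∉ S) {u v : V} (hu : u ∈ S)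
    (hv : v ∉ S) : (A ⊔ B ⊔ SimpleGraph.edge u v).IsAcyclic :=
  (isAcyclic_sup_of_disjoint hA hB hAS hBS).sup_edge_of_not_reachable fun ⟨p⟩ =>
    hv (walk_sup_mem_left (fun x y h => hAS y x h.symm) hBS p hu).1

end Acyclic

open scoped Classical in
/-- Attaching trees to a tree, each by one edge, yields an acyclic graph. -/
theorem isAcyclic_attach (c : Cluster V) (m : Cluster V → Sym2 V) (D : Finset (Cluster V))
    (hc : c.tree.IsAcyclic) (hcv : ∀ e ∈ c.edges, ∀ x ∈ e, x ∈ c.verts)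
    (hD : ∀ b ∈ D, b.tree.IsAcyclic) (hDv : ∀ b ∈ D, ∀ e ∈ b.edges, ∀ x ∈ e, x ∈ b.verts)
    (hcD : ∀ b ∈ D, Disjoint c.verts b.verts)
    (hDD : ∀ b ∈ D, ∀ b' ∈ D, b ≠ b' → Disjoint b.verts b'.verts)
    (hm : ∀ b ∈ D, ∃ x ∈ b.verts, ∃ y ∈ c.verts, m b = s(x, y)) :
    (SimpleGraph.fromEdgeSet
      ((c.edges ∪ D.biUnion fun b => insert (m b) b.edges : Finset (Sym2 V)) :
        Set (Sym2 V))).IsAcyclic := by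
  induction D using Finset.induction_on with
  | empty => simpa [Cluster.tree] using hc
  | insert b D hb ih =>
    simp only [Finset.forall_mem_insert] at hD hDv hcD hm
    have ih' := ih hD.2 hDv.2 hcD.2
      (fun b' h b'' h' => hDD b' (Finset.mem_insert_of_mem h) b'' (Finset.mem_insert_of_mem h'))
      hm.2
    obtain ⟨x, hx, y, hy, hxy⟩ := hm.1
    have hb' : ∀ b' ∈ D, Disjoint b.verts b'.verts := fun b' h =>
      hDD b (Finset.mem_insert_self _ _) b' (Finset.mem_insert_of_mem h)
        (fun h' => hb (h' ▸ h))
    have key := isAcyclic_sup_edge (u := y) (v := x)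
      -- `S` contains all vertices touched so far. The new edge joins `y` in `S` to `x` outside it,
      -- hence two different components.
      (S := ((c.verts ∪ D.biUnion Cluster.verts : Finset V) : Set V)) ih' hD.1 ?_ ?_ ?_ ?_
    · refine key.anti fun p q hpq => ?_
      simp only [SimpleGraph.fromEdgeSet_adj, SimpleGraph.sup_adj, Cluster.tree,
        SimpleGraph.edge_adj, Finset.mem_coe, Finset.mem_union, Finset.biUnion_insert,
        Finset.mem_insert] at hpq ⊢
      rw [hxy, Sym2.eq_iff] at hpq
      tauto
    · intro p q hpq
      simp only [SimpleGraph.fromEdgeSet_adj, Finset.mem_coe, Finset.mem_union, Finset.mem_biUnion,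
        Finset.mem_insert] at hpq ⊢
      rcases hpq.1 with h | ⟨d, hd, h | h⟩
      · exact Or.inl (hcv _ h p (by simp))
      · obtain ⟨x', hx', y', hy', h'⟩ := hm.2 d hd
        rw [h', Sym2.eq_iff] at h
        rcases h with ⟨rfl, rfl⟩ | ⟨rfl, rfl⟩
        · exact Or.inr ⟨d, hd, hx'⟩
        · exact Or.inl hy'
      · exact Or.inr ⟨d, hd, hDv.2 d hd _ h p (by simp)⟩
    · intro p q hpq hp
      simp only [Cluster.tree, SimpleGraph.fromEdgeSet_adj, Finset.mem_coe] at hpq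
      have hpb := hDv.1 _ hpq.1 p (by simp)
      simp only [Finset.mem_coe, Finset.mem_union, Finset.mem_biUnion] at hp
      rcases hp with h | ⟨d, hd, h⟩
      · exact Finset.disjoint_left.mp hcD.1 h hpb
      · exact Finset.disjoint_left.mp (hb' d hd) hpb h
    · simp [hy]
    · intro h
      simp only [Finset.mem_coe, Finset.mem_union, Finset.mem_biUnion] at h
      rcases h with h | ⟨d, hd, h⟩
      · exact Finset.disjoint_left.mp hcD.1 h hx
      · exact Finset.disjoint_left.mp (hb' d hd) hx h

/-! ### The invariant and its initial case -/

/-- The invariant of the first phase: hop radius `r` of the clusters, and hop bound `K` for the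
replacement walks of the discarded edges. -/
structure Invariant (G : SimpleGraph V) (w : Sym2 V → ℝ≥0) (r K : ℕ) (s : State V) : Prop where
  isClustering : IsClustering G s.clusters
  within_root : ∀ c ∈ s.clusters, ∀ x ∈ c.verts, Within c.tree (fun _ => True) r x c.root
  within_root_light : ∀ e ∈ s.unprocessed, ∀ c ∈ s.clusters, ∀ x ∈ c.verts, x ∈ e →
    Within c.tree (fun f => w f ≤ w e) r x c.root
  unprocessed_subset : ∀ e ∈ s.unprocessed, e ∈ G.edgeSet
  covers : ∀ e ∈ s.unprocessed, ∀ x ∈ e, ∃ c ∈ s.clusters, x ∈ c.verts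
  spanner_subset : ∀ e ∈ s.spanner, e ∈ G.edgeSet
  edges_subset : ∀ c ∈ s.clusters, c.edges ⊆ s.spanner
  within_spanner : ∀ x y, G.Adj x y → s(x, y) ∉ s.unprocessed →
    Within (SimpleGraph.fromEdgeSet (s.spanner : Set (Sym2 V)))
      (fun f => w f ≤ w s(x, y)) K x y

theorem mem_edgesBetween {E : Finset (Sym2 V)} {c c' : Cluster V} {e : Sym2 V} :
    e ∈ edgesBetween E c c' ↔ e ∈ E ∧ ∃ x ∈ c.verts, ∃ y ∈ c'.verts, e = s(x, y) := by
  simp [edgesBetween]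

theorem mem_edgesFrom {E : Finset (Sym2 V)} {v : V} {c : Cluster V} {e : Sym2 V} :
    e ∈ edgesFrom E v c ↔ e ∈ E ∧ ∃ y ∈ c.verts, e = s(v, y) := by
  simp [edgesFrom]

theorem invariant_init [Fintype V] (G : SimpleGraph V) (w : Sym2 V → ℝ≥0) (K : ℕ) :
    Invariant G w 0 K (State.init G) where
  isClustering := by
    constructor
    · simp only [State.init, Finset.mem_image, Finset.mem_univ, true_and, forall_exists_index,
        forall_apply_eq_imp_iff]
      intro v
      constructor <;> simp [Cluster.tree]
    · simp only [State.init, Finset.mem_image, Finset.mem_univ, true_and, forall_exists_index,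
        forall_apply_eq_imp_iff]
      intro u v h
      rw [Finset.disjoint_singleton]
      rintro rfl
      exact h rfl
  within_root := by
    simp only [State.init, Finset.mem_image, Finset.mem_univ, true_and, forall_exists_index,
      forall_apply_eq_imp_iff, Finset.mem_singleton, forall_eq]
    exact fun v => Within.refl _ _ _ _
  within_root_light := by
    simp only [State.init, Finset.mem_image, Finset.mem_univ, true_and, forall_exists_index,
      forall_apply_eq_imp_iff, Finset.mem_singleton, forall_eq]
    exact fun e _ v _ => Within.refl _ _ _ _
  unprocessed_subset := by simp [State.init]
  covers := by simp [State.init]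
  spanner_subset := by simp [State.init]
  edges_subset := by simp [State.init]
  within_spanner x y h h' := absurd h (by simpa [State.init] using h')

/-! ### One epoch preserves the invariant -/

section Step

variable {G : SimpleGraph V} {w : Sym2 V → ℝ≥0} {r K : ℕ} {s : State V} {R : Finset (Cluster V)}
  (ch : Choice w)

theorem mergeEdge_spec {b : Cluster V} (hb : HasSampledNeighbor s R b) :
    mergeEdge ch s R b ∈ s.unprocessed ∧ ∃ x ∈ b.verts,
      ∃ y ∈ (ch.closest s.unprocessed R b).verts, mergeEdge ch s R b = s(x, y) :=
  mem_edgesBetween.mp (ch.lowest_mem _ (ch.closest_neighbors _ _ _ hb))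

theorem mem_absorbed {b c : Cluster V} : b ∈ absorbed ch s R c ↔
    (b ∈ s.clusters ∧ b ∉ R) ∧ HasSampledNeighbor s R b ∧ ch.closest s.unprocessed R b = c := by
  simp [absorbed]

theorem mem_processedPairs {q : Cluster V × Cluster V} : q ∈ processedPairs ch s R ↔
    ((q.1 ∈ s.clusters ∧ q.1 ∉ R) ∧ q.2 ∈ s.clusters) ∧ Processes ch s R q.1 q.2 := by
  simp [processedPairs]

theorem tree_le_grow (c : Cluster V) : c.tree ≤ (grow ch s R c).tree :=
  SimpleGraph.fromEdgeSet_mono (by simp [grow])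

theorem absorbed_edges_subset_grow {b c : Cluster V} (hb : b ∈ absorbed ch s R c) :
    b.edges ⊆ (grow ch s R c).edges := by
  intro e he
  simp only [grow, Finset.mem_union, Finset.mem_biUnion, Finset.mem_insert]
  exact Or.inr ⟨b, hb, Or.inr he⟩

theorem mergeEdge_mem_grow {b c : Cluster V} (hb : b ∈ absorbed ch s R c) :
    mergeEdge ch s R b ∈ (grow ch s R c).edges := by
  simp only [grow, Finset.mem_union, Finset.mem_biUnion, Finset.mem_insert]
  exact Or.inr ⟨b, hb, Or.inl rfl⟩

theorem mem_grow_verts {c : Cluster V} {x : V} : x ∈ (grow ch s R c).verts ↔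
    x ∈ c.verts ∨ ∃ b ∈ absorbed ch s R c, x ∈ b.verts := by
  simp [grow]

open scoped Classical in
/-- The edges that are not discarded when the clusters are considered. -/
noncomputable def keptEdges (ch : Choice w) (s : State V) (R : Finset (Cluster V)) :
    Finset (Sym2 V) :=
  s.unprocessed \ (processedPairs ch s R).biUnion fun q => edgesBetween s.unprocessed q.1 q.2

theorem mem_keptEdges {e : Sym2 V} : e ∈ keptEdges ch s R ↔ e ∈ s.unprocessed ∧
    ∀ b ∈ s.clusters, b ∉ R → ∀ c ∈ s.clusters, Processes ch s R b c →
      e ∉ edgesBetween s.unprocessed b c := by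
  simp only [keptEdges, Finset.mem_sdiff, Finset.mem_biUnion, mem_processedPairs, Prod.exists]
  refine and_congr_right fun _ => ⟨fun h b hb hbR c hc hp he => h ⟨b, c, ⟨⟨⟨hb, hbR⟩, hc⟩, hp⟩, he⟩,
    ?_⟩
  rintro h ⟨b, c, ⟨⟨⟨hb, hbR⟩, hc⟩, hp⟩, he⟩
  exact h b hb hbR c hc hp he

theorem mem_step_unprocessed {e : Sym2 V} : e ∈ (s.step ch R).unprocessed ↔
    e ∈ keptEdges ch s R ∧ ∀ c ∈ R, ∃ x ∈ e, x ∉ (grow ch s R c).verts := by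
  simp [State.step, keptEdges]

theorem Processes.edgesBetween_nonempty {b c : Cluster V} (h : Processes ch s R b c) :
    (edgesBetween s.unprocessed b c).Nonempty := by
  rcases h with ⟨hn, rfl | ⟨f, hf, -⟩⟩ | ⟨-, h⟩
  · exact ch.closest_neighbors _ _ _ hn
  · exact ⟨f, hf⟩
  · exact h

theorem lowest_mem_step {b c : Cluster V} (hb : b ∈ s.clusters) (hbR : b ∉ R)
    (hc : c ∈ s.clusters) (h : Processes ch s R b c) :
    ch.lowest (edgesBetween s.unprocessed b c) ∈ (s.step ch R).spanner := by
  classical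
  simp only [State.step, Finset.mem_union, Finset.mem_image]
  exact Or.inr ⟨(b, c), (mem_processedPairs ch).mpr ⟨⟨⟨hb, hbR⟩, hc⟩, h⟩, rfl⟩

namespace Invariant

variable {ch}

theorem adj_of_edge_mem (inv : Invariant G w r K s)
    {u v : V} {E : Finset (Sym2 V)} (h : s(u, v) ∈ E)
    (h' : s(u, v) ∈ s.unprocessed) :
    (SimpleGraph.fromEdgeSet (E : Set (Sym2 V))).Adj u v := by
  rw [SimpleGraph.fromEdgeSet_adj]
  exact ⟨h, SimpleGraph.Adj.ne (inv.unprocessed_subset _ h')⟩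

/-- The merge edge was itself unprocessed, so the invariant applied to it makes the tree walks from
its two ends light in both `b` and `c`. The legs `x` to the root of `b`, back to the merge edge,
across, and up to the root of `c` have `r + r + 1 + r` hops. -/
theorem within_grow (inv : Invariant G w r K s) (hR : R ⊆ s.clusters)
    {P : Sym2 V → Prop} {b c : Cluster V} (hb : b ∈ absorbed ch s R c)
    (hP : ∀ f, w f ≤ w (mergeEdge ch s R b) → P f) {x : V} (hx : Within b.tree P r x b.root) :
    Within (grow ch s R c).tree P (3 * r + 1) x c.root := by
  have hb' := (mem_absorbed ch).mp hb
  obtain ⟨he, u, hu, v, hv, huv⟩ := mergeEdge_spec ch hb'.2.1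
  have hc : ch.closest s.unprocessed R b ∈ R := ch.closest_mem _ _ _ hb'.2.1
  rw [hb'.2.2] at hv hc
  have hbt : b.tree ≤ (grow ch s R c).tree :=
    SimpleGraph.fromEdgeSet_mono (Finset.coe_subset.mpr (absorbed_edges_subset_grow ch hb))
  have h1 := hx.mono hbt (fun _ h => h) le_rfl
  have h2 := (inv.within_root_light _ he b hb'.1.1 u hu (by simp [huv])).symm.mono hbt hP le_rfl
  have h3 := (inv.within_root_light _ he c (hR hc) v hv (by simp [huv])).mono
    (tree_le_grow (s := s) (R := R) ch c) hP le_rfl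
  have h4 : (grow ch s R c).tree.Adj u v :=
    inv.adj_of_edge_mem (huv ▸ mergeEdge_mem_grow ch hb) (huv ▸ he)
  exact (((h1.trans h2).trans (Within.of_adj h4 (hP _ (by rw [huv])))).trans h3).mono le_rfl
    (fun _ h => h) (by omega)

theorem within_grow_root (inv : Invariant G w r K s) (hR : R ⊆ s.clusters)
    {c : Cluster V} (hc : c ∈ R) {x : V} (hx : x ∈ (grow ch s R c).verts) :
    Within (grow ch s R c).tree (fun _ => True) (3 * r + 1) x c.root := by
  rcases (mem_grow_verts ch).mp hx with hx | ⟨b, hb, hx⟩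
  · exact (inv.within_root c (hR hc) x hx).mono (tree_le_grow ch c) (fun _ h => h) (by omega)
  · exact inv.within_grow hR hb (fun _ _ => trivial)
      (inv.within_root b ((mem_absorbed ch).mp hb).1.1 x hx)

/-- By `covers` the other end of `e` lies in some cluster `c`. Were `e` strictly lighter than the
merge edge, the pair `(b, c)` would be processed and `e` discarded. -/
theorem weight_mergeEdge_le (inv : Invariant G w r K s)
    {e : Sym2 V} (he : e ∈ keptEdges ch s R) {b : Cluster V}
    (hb : b ∈ s.clusters) (hbR : b ∉ R) (hn : HasSampledNeighbor s R b) {x : V} (hx : x ∈ b.verts)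
    (hxe : x ∈ e) : w (mergeEdge ch s R b) ≤ w e := by
  rw [mem_keptEdges] at he
  obtain ⟨y, rfl⟩ := Sym2.mem_iff_exists.mp hxe
  obtain ⟨c, hc, hy⟩ := inv.covers _ he.1 y (by simp)
  have hbc : s(x, y) ∈ edgesBetween s.unprocessed b c :=
    mem_edgesBetween.mpr ⟨he.1, x, hx, y, hy, rfl⟩
  by_contra! h
  exact he.2 b hb hbR c hc (Or.inl ⟨hn, Or.inr ⟨_, hbc, h⟩⟩) hbc

theorem within_grow_root_light (inv : Invariant G w r K s) (hR : R ⊆ s.clusters)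
    {e : Sym2 V} (he : e ∈ keptEdges ch s R) {c : Cluster V}
    (hc : c ∈ R) {x : V} (hx : x ∈ (grow ch s R c).verts) (hxe : x ∈ e) :
    Within (grow ch s R c).tree (fun f => w f ≤ w e) (3 * r + 1) x c.root := by
  have he' := ((mem_keptEdges ch).mp he).1
  rcases (mem_grow_verts ch).mp hx with hx | ⟨b, hb, hx⟩
  · exact (inv.within_root_light e he' c (hR hc) x hx hxe).mono (tree_le_grow ch c)
      (fun _ h => h) (by omega)
  · have hb' := (mem_absorbed ch).mp hb
    exact inv.within_grow hR hb
      (fun _ h => h.trans (inv.weight_mergeEdge_le he hb'.1.1 hb'.1.2 hb'.2.1 hx hxe))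
      (inv.within_root_light e he' b hb'.1.1 x hx hxe)

/-- Only unsampled clusters without a sampled neighbor drop out of the clustering, and all their
edges to other clusters are processed, so no kept edge loses its cluster. -/
theorem covers_keptEdges (inv : Invariant G w r K s)
    {e : Sym2 V} (he : e ∈ keptEdges ch s R) {x : V} (hxe : x ∈ e) :
    ∃ c ∈ R, x ∈ (grow ch s R c).verts := by
  rw [mem_keptEdges] at he
  obtain ⟨b, hb, hx⟩ := inv.covers e he.1 x hxe
  by_cases hbR : b ∈ R
  · exact ⟨b, hbR, (mem_grow_verts ch).mpr (Or.inl hx)⟩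
  by_cases hn : HasSampledNeighbor s R b
  · exact ⟨_, ch.closest_mem _ _ _ hn, (mem_grow_verts ch).mpr
      (Or.inr ⟨b, (mem_absorbed ch).mpr ⟨⟨hb, hbR⟩, hn, rfl⟩, hx⟩)⟩
  · obtain ⟨y, rfl⟩ := Sym2.mem_iff_exists.mp hxe
    obtain ⟨c, hc, hy⟩ := inv.covers _ he.1 y (by simp)
    have hbc : s(x, y) ∈ edgesBetween s.unprocessed b c :=
      mem_edgesBetween.mpr ⟨he.1, x, hx, y, hy, rfl⟩
    exact absurd hbc (he.2 b hb hbR c hc (Or.inr ⟨hn, ⟨_, hbc⟩⟩))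

theorem grow_edges_subset (inv : Invariant G w r K s) (hR : R ⊆ s.clusters)
    {c : Cluster V} (hc : c ∈ R) :
    (grow ch s R c).edges ⊆ (s.step ch R).spanner := by
  classical
  intro e he
  simp only [grow, Finset.mem_union, Finset.mem_biUnion, Finset.mem_insert] at he
  simp only [State.step, Finset.mem_union, Finset.mem_image]
  rcases he with he | ⟨b, hb, rfl | he⟩
  · exact Or.inl (inv.edges_subset c (hR hc) he)
  · have hb' := (mem_absorbed ch).mp hb
    refine Or.inr ⟨(b, ch.closest s.unprocessed R b), (mem_processedPairs ch).mpr
      ⟨⟨hb'.1, hR (ch.closest_mem _ _ _ hb'.2.1)⟩, Or.inl ⟨hb'.2.1, Or.inl rfl⟩⟩, rfl⟩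
  · exact Or.inl (inv.edges_subset b ((mem_absorbed ch).mp hb).1.1 he)

theorem step_spanner_subset (inv : Invariant G w r K s) :
    ∀ e ∈ (s.step ch R).spanner, e ∈ G.edgeSet := by
  classical
  intro e he
  simp only [State.step, Finset.mem_union, Finset.mem_image] at he
  rcases he with he | ⟨q, hq, rfl⟩
  · exact inv.spanner_subset e he
  · exact inv.unprocessed_subset _ (mem_edgesBetween.mp
      (ch.lowest_mem _ (Processes.edgesBetween_nonempty ch ((mem_processedPairs ch).mp hq).2))).1

theorem isRootedTree_grow (inv : Invariant G w r K s) (hR : R ⊆ s.clusters)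
    {c : Cluster V} (hc : c ∈ R) : (grow ch s R c).IsRootedTree G where
  root_mem := (mem_grow_verts ch).mpr (Or.inl (inv.isClustering.rootedTree c (hR hc)).root_mem)
  edges_subset e he := inv.step_spanner_subset e (inv.grow_edges_subset hR hc he)
  edges_inside e he x hx := by
    classical
    rw [mem_grow_verts]
    simp only [grow, Finset.mem_union, Finset.mem_biUnion, Finset.mem_insert] at he
    rcases he with he | ⟨b, hb, rfl | he⟩
    · exact Or.inl ((inv.isClustering.rootedTree c (hR hc)).edges_inside e he x hx)
    · have hb' := (mem_absorbed ch).mp hb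
      obtain ⟨-, u, hu, v, hv, huv⟩ := mergeEdge_spec ch hb'.2.1
      rw [huv, Sym2.mem_iff] at hx
      rcases hx with rfl | rfl
      · exact Or.inr ⟨b, hb, hu⟩
      · exact Or.inl (hb'.2.2 ▸ hv)
    · exact Or.inr ⟨b, hb,
        (inv.isClustering.rootedTree b ((mem_absorbed ch).mp hb).1.1).edges_inside e he x hx⟩
  acyclic := by
    have hD : ∀ b ∈ absorbed ch s R c, b ∈ s.clusters := fun b hb => ((mem_absorbed ch).mp hb).1.1
    refine isAcyclic_attach c (mergeEdge ch s R) (absorbed ch s R c)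
      (inv.isClustering.rootedTree c (hR hc)).acyclic
      (inv.isClustering.rootedTree c (hR hc)).edges_inside
      (fun b hb => (inv.isClustering.rootedTree b (hD b hb)).acyclic)
      (fun b hb => (inv.isClustering.rootedTree b (hD b hb)).edges_inside)
      (fun b hb => inv.isClustering.disjoint c (hR hc) b (hD b hb) ?_)
      (fun b hb b' hb' => inv.isClustering.disjoint b (hD b hb) b' (hD b' hb'))
      (fun b hb => ?_)
    · rintro rfl
      exact ((mem_absorbed ch).mp hb).1.2 hc
    · have hb' := (mem_absorbed ch).mp hb
      exact hb'.2.2 ▸ (mergeEdge_spec ch hb'.2.1).2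
  connected x hx := (inv.within_grow_root hR hc hx).reachable

theorem isClustering_step (inv : Invariant G w r K s) (hR : R ⊆ s.clusters) :
    IsClustering G (s.step ch R).clusters := by
  classical
  constructor
  · simp only [State.step, Finset.mem_image, forall_exists_index, and_imp,
      forall_apply_eq_imp_iff₂]
    exact fun c hc => inv.isRootedTree_grow hR hc
  · simp only [State.step, Finset.mem_image, forall_exists_index, and_imp,
      forall_apply_eq_imp_iff₂]
    intro c hc c' hc' hne
    have hcc' : c ≠ c' := fun h => hne (h ▸ rfl)
    rw [Finset.disjoint_left]
    intro x hx hx'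
    -- A vertex determines its old cluster, and an old cluster determines where it goes: to itself
    -- if sampled, to its closest sampled neighbor otherwise.
    have key : ∀ d ∈ s.clusters, ∀ d' ∈ s.clusters, x ∈ d.verts → x ∈ d'.verts → d = d' :=
      fun d hd d' hd' h h' => by
        by_contra hdd
        exact Finset.disjoint_left.mp (inv.isClustering.disjoint d hd d' hd' hdd) h h'
    rw [mem_grow_verts] at hx hx'
    rcases hx with hx | ⟨b, hb, hx⟩ <;> rcases hx' with hx' | ⟨b', hb', hx'⟩
    · exact hcc' (key c (hR hc) c' (hR hc') hx hx')
    · rw [mem_absorbed] at hb'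
      exact hb'.1.2 (key c (hR hc) b' hb'.1.1 hx hx' ▸ hc)
    · rw [mem_absorbed] at hb
      exact hb.1.2 (key b hb.1.1 c' (hR hc') hx hx' ▸ hc')
    · rw [mem_absorbed] at hb hb'
      have h := key b hb.1.1 b' hb'.1.1 hx hx'
      subst h
      exact hcc' (hb.2.2.symm.trans hb'.2.2)

theorem within_step_spanner (inv : Invariant G w r K s) (hR : R ⊆ s.clusters)
    (hK : 4 * r + 1 ≤ K) {K' : ℕ} (hK' : K ≤ K') (hK'' : 6 * r + 2 ≤ K')
    {x y : V} (hxy : G.Adj x y) (h : s(x, y) ∉ (s.step ch R).unprocessed) :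
    Within (SimpleGraph.fromEdgeSet ((s.step ch R).spanner : Set (Sym2 V)))
      (fun f => w f ≤ w s(x, y)) K' x y := by
  classical
  have hs : s.spanner ⊆ (s.step ch R).spanner := by simp [State.step]
  by_cases h1 : s(x, y) ∈ s.unprocessed
  swap
  · exact (inv.within_spanner x y hxy h1).mono
      (SimpleGraph.fromEdgeSet_mono (Finset.coe_subset.mpr hs)) (fun _ h => h) hK'
  by_cases h2 : s(x, y) ∈ keptEdges ch s R
  -- The edge was removed for lying inside one new cluster: detour through its root, `2(3r + 1) = 6r
  -- + 2` hops.
  · rw [mem_step_unprocessed, not_and] at h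
    have h3 := h h2
    push Not at h3
    obtain ⟨c, hc, hxy'⟩ := h3
    have hle : (grow ch s R c).tree ≤
        SimpleGraph.fromEdgeSet ((s.step ch R).spanner : Set (Sym2 V)) :=
      SimpleGraph.fromEdgeSet_mono (Finset.coe_subset.mpr (inv.grow_edges_subset hR hc))
    exact ((inv.within_grow_root_light hR h2 hc (hxy' x (by simp)) (by simp)).trans
      (inv.within_grow_root_light hR h2 hc (hxy' y (by simp)) (by simp)).symm).mono hle
      (fun _ h => h) (by omega)
  · have h3 : ∃ b ∈ s.clusters, b ∉ R ∧ ∃ c ∈ s.clusters, Processes ch s R b c ∧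
        s(x, y) ∈ edgesBetween s.unprocessed b c := by
      rw [mem_keptEdges, not_and] at h2
      have := h2 h1
      push Not at this
      obtain ⟨b, hb, hbR, c, hc, hp, he⟩ := this
      exact ⟨b, hb, hbR, c, hc, hp, he⟩
    -- The edge was discarded with a processed pair: detour via the root of `b`, the chosen edge `f`
    -- and the root of `c`, `4r + 1` hops. Legs ending at `f` are light for `f`, hence for the
    -- heavier `s(x, y)`.
    obtain ⟨b, hb, hbR, c, hc, hp, he⟩ := h3
    have hl := ch.lowest_mem _ ⟨_, he⟩
    have hle := ch.lowest_le _ _ he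
    have hmem := lowest_mem_step ch hb hbR hc hp
    set f := ch.lowest (edgesBetween s.unprocessed b c)
    obtain ⟨hfE, u, hu, v, hv, huv⟩ := mem_edgesBetween.mp hl
    obtain ⟨-, x', hx', y', hy', hxy'⟩ := mem_edgesBetween.mp he
    have ht : ∀ d ∈ s.clusters, d.tree ≤
        SimpleGraph.fromEdgeSet ((s.step ch R).spanner : Set (Sym2 V)) := fun d hd =>
      SimpleGraph.fromEdgeSet_mono (Finset.coe_subset.mpr ((inv.edges_subset d hd).trans hs))
    have hf : ∀ g, w g ≤ w f → w g ≤ w s(x, y) := fun g hg => hg.trans hle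
    have k1 := (inv.within_root_light _ h1 b hb x' hx' (by simp [hxy'])).mono (ht b hb)
      (fun _ h => h) le_rfl
    have k2 := (inv.within_root_light _ hfE b hb u hu (by simp [huv])).symm.mono (ht b hb)
      hf le_rfl
    have k3 : Within (SimpleGraph.fromEdgeSet ((s.step ch R).spanner : Set (Sym2 V)))
        (fun g => w g ≤ w s(x, y)) 1 u v :=
      Within.of_adj (inv.adj_of_edge_mem (huv ▸ hmem) (huv ▸ hfE)) (huv ▸ hle)
    have k4 := (inv.within_root_light _ hfE c hc v hv (by simp [huv])).mono (ht c hc) hf le_rfl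
    have k5 := (inv.within_root_light _ h1 c hc y' hy' (by simp [hxy'])).symm.mono (ht c hc)
      (fun _ h => h) le_rfl
    have k := ((((k1.trans k2).trans k3).trans k4).trans k5).mono le_rfl (fun _ h => h)
      (show _ ≤ K' by omega)
    -- The end in `b` may be `x` or `y`.
    rcases Sym2.eq_iff.mp hxy' with ⟨rfl, rfl⟩ | ⟨rfl, rfl⟩
    · exact k
    · exact k.symm

theorem step (inv : Invariant G w r K s) (hR : R ⊆ s.clusters)
    (hK : 4 * r + 1 ≤ K) {K' : ℕ} (hK' : K ≤ K') (hK'' : 6 * r + 2 ≤ K') :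
    Invariant G w (3 * r + 1) K' (s.step ch R) where
  isClustering := inv.isClustering_step hR
  within_root := by
    classical
    simp only [State.step, Finset.mem_image, forall_exists_index, and_imp,
      forall_apply_eq_imp_iff₂]
    exact fun c hc x hx => inv.within_grow_root hR hc hx
  within_root_light e he := by
    classical
    rw [mem_step_unprocessed] at he
    simp only [State.step, Finset.mem_image, forall_exists_index, and_imp,
      forall_apply_eq_imp_iff₂]
    exact fun c hc x hx hxe => inv.within_grow_root_light hR he.1 hc hx hxe
  unprocessed_subset e he :=
    inv.unprocessed_subset e ((mem_keptEdges ch).mp ((mem_step_unprocessed ch).mp he).1).1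
  covers e he x hx := by
    classical
    obtain ⟨c, hc, h⟩ := inv.covers_keptEdges ((mem_step_unprocessed ch).mp he).1 hx
    exact ⟨_, Finset.mem_image_of_mem _ hc, h⟩
  spanner_subset := inv.step_spanner_subset
  edges_subset := by
    classical
    intro c hc
    simp only [State.step, Finset.mem_image] at hc
    obtain ⟨c, hc, rfl⟩ := hc
    exact inv.grow_edges_subset hR hc
  within_spanner _ _ := inv.within_step_spanner hR hK hK' hK''

end Invariant

/-! ### What the invariant gives: radius and stretch -/

theorem Invariant.hasWeightedStretchRadius (inv : Invariant G w r K s) :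
    HasWeightedStretchRadius G w s.clusters s.unprocessed r where
  isClustering := inv.isClustering
  radius_le c hc := by
    have : c.radius ≤ r := Finset.sup_le fun x hx => (inv.within_root c hc x hx).dist_le
    exact_mod_cast this
  weight_le e he c hc x hx hxe p hp :=
    (inv.within_root_light e he c hc x hx hxe).forall_path_edges
      (inv.isClustering.rootedTree c hc).acyclic p hp

theorem Invariant.output_subset [Fintype V] (inv : Invariant G w r K s) :
    ∀ e ∈ s.output ch, e ∈ G.edgeSet := by
  classical
  intro e he
  simp only [State.output, Finset.mem_union, Finset.mem_image, Finset.mem_filter] at he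
  rcases he with he | ⟨q, ⟨-, hq⟩, rfl⟩
  · exact inv.spanner_subset e he
  · exact inv.unprocessed_subset _ (mem_edgesFrom.mp (ch.lowest_mem _ hq)).1

theorem Invariant.within_output [Fintype V] (inv : Invariant G w r K s) {N : ℕ} (hN : K ≤ N)
    (hN' : 2 * r + 1 ≤ N) {x y : V} (hxy : G.Adj x y) :
    Within (SimpleGraph.fromEdgeSet (s.output ch : Set (Sym2 V)))
      (fun f => w f ≤ w s(x, y)) N x y := by
  classical
  have hs : s.spanner ⊆ s.output ch := by simp [State.output]
  by_cases h : s(x, y) ∈ s.unprocessed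
  swap
  · exact (inv.within_spanner x y hxy h).mono
      (SimpleGraph.fromEdgeSet_mono (Finset.coe_subset.mpr hs)) (fun _ h => h) hN
  -- Only the cluster of `y` is used, with `x` as a bare vertex: one chosen edge into it, then up to
  -- the root and down to `y`, `2r + 1` hops.
  obtain ⟨c, hc, hy⟩ := inv.covers _ h y (by simp)
  have he : s(x, y) ∈ edgesFrom s.unprocessed x c := mem_edgesFrom.mpr ⟨h, y, hy, rfl⟩
  have hl := ch.lowest_mem _ ⟨_, he⟩
  have hle := ch.lowest_le _ _ he
  have hmem : ch.lowest (edgesFrom s.unprocessed x c) ∈ s.output ch := by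
    simp only [State.output, Finset.mem_union, Finset.mem_image, Finset.mem_filter]
    exact Or.inr ⟨(x, c), ⟨by simp [hc], ⟨_, he⟩⟩, rfl⟩
  set f := ch.lowest (edgesFrom s.unprocessed x c)
  obtain ⟨hfE, v, hv, hxv⟩ := mem_edgesFrom.mp hl
  have ht : c.tree ≤ SimpleGraph.fromEdgeSet (s.output ch : Set (Sym2 V)) :=
    SimpleGraph.fromEdgeSet_mono (Finset.coe_subset.mpr ((inv.edges_subset c hc).trans hs))
  have hadj : (SimpleGraph.fromEdgeSet (s.output ch : Set (Sym2 V))).Adj x v :=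
    inv.adj_of_edge_mem (hxv ▸ hmem) (hxv ▸ hfE)
  have k1 : Within (SimpleGraph.fromEdgeSet (s.output ch : Set (Sym2 V)))
      (fun g => w g ≤ w s(x, y)) 1 x v := Within.of_adj hadj (hxv ▸ hle)
  have k2 := (inv.within_root_light _ hfE c hc v hv (by simp [hxv])).mono ht
    (fun g hg => hg.trans hle) le_rfl
  have k3 := (inv.within_root_light _ h c hc y hy (by simp)).symm.mono ht (fun _ h => h) le_rfl
  exact ((k1.trans k2).trans k3).mono le_rfl (fun _ h => h) (by omega)

end Step

theorem subset_of_mem_support_sample {α : Type*} {p : ℝ≥0} {hp : p ≤ 1} {S R : Finset α}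
    (h : R ∈ (sample p hp S).support) : R ⊆ S := by
  rw [sample, PMF.mem_support_ofFinset_iff] at h
  exact Finset.mem_powerset.mp h.1

theorem exists_invariant [Fintype V] {G : SimpleGraph V} {w : Sym2 V → ℝ≥0} (ch : Choice w)
    (k : ℝ≥0) (i : ℕ) (s : State V) (hs : s ∈ (phaseOne G ch k i).support) :
    ∃ r : ℕ, 2 * r + 1 = 3 ^ i ∧ Invariant G w r (2 * 3 ^ i) s := by
  induction i generalizing s with
  | zero =>
    rw [phaseOne, PMF.support_pure, Set.mem_singleton_iff] at hs
    exact ⟨0, by simp, hs ▸ invariant_init G w _⟩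
  | succ i ih =>
    rw [phaseOne, PMF.mem_support_bind_iff] at hs
    obtain ⟨s₀, hs₀, hs⟩ := hs
    rw [PMF.mem_support_map_iff] at hs
    obtain ⟨R, hR, rfl⟩ := hs
    obtain ⟨r, hr, inv⟩ := ih s₀ hs₀
    -- With `2r + 1 = 3^i` the hop bounds are `K = 4r + 2` and `K' = 12r + 6`, which leaves room for
    -- `4r + 1` and `6r + 2`.
    exact ⟨3 * r + 1, by rw [pow_succ]; omega, inv.step (subset_of_mem_support_sample hR)
      (by omega) (by rw [pow_succ]; omega) (by rw [pow_succ]; omega)⟩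

/-! ### Expectations, and independent sampling -/

/-- The expectation of `g` under the probability mass function `P`. -/
noncomputable def expect {α : Type*} (P : PMF α) (g : α → ℝ≥0∞) : ℝ≥0∞ := ∑' a, P a * g a

section Expect

variable {α β : Type*}

theorem expect_pure (a : α) (g : α → ℝ≥0∞) : expect (PMF.pure a) g = g a := by
  rw [expect, tsum_eq_single a (fun b hb => by simp [PMF.pure_apply, hb])]
  simp

theorem expect_bind (P : PMF α) (Q : α → PMF β) (g : β → ℝ≥0∞) :
    expect (P.bind Q) g = expect P fun a => expect (Q a) g := by
  simp only [expect, PMF.bind_apply, ← ENNReal.tsum_mul_right, ← ENNReal.tsum_mul_left]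
  rw [ENNReal.tsum_comm]
  simp only [mul_assoc]

theorem expect_map (P : PMF α) (f : α → β) (g : β → ℝ≥0∞) :
    expect (P.map f) g = expect P fun a => g (f a) := by
  rw [← PMF.bind_pure_comp, expect_bind]
  simp only [Function.comp_apply, expect_pure]

theorem expect_mono {P : PMF α} {g h : α → ℝ≥0∞} (hgh : ∀ a ∈ P.support, g a ≤ h a) :
    expect P g ≤ expect P h := by
  refine ENNReal.tsum_le_tsum fun a => ?_
  by_cases ha : a ∈ P.support
  · gcongr
    exact hgh a ha
  · rw [PMF.mem_support_iff, not_not] at ha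
    simp [ha]

theorem expect_add (P : PMF α) (g h : α → ℝ≥0∞) :
    expect P (fun a => g a + h a) = expect P g + expect P h := by
  simp only [expect, mul_add, ENNReal.tsum_add]

theorem expect_mul_const (P : PMF α) (g : α → ℝ≥0∞) (c : ℝ≥0∞) :
    expect P (fun a => g a * c) = expect P g * c := by
  simp only [expect, ← mul_assoc, ENNReal.tsum_mul_right]

theorem expect_const (P : PMF α) (c : ℝ≥0∞) : expect P (fun _ => c) = c := by
  simp only [expect, ENNReal.tsum_mul_right, PMF.tsum_coe, one_mul]

theorem expect_sum {ι : Type*} (P : PMF α) (t : Finset ι) (g : ι → α → ℝ≥0∞) :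
    expect P (fun a => ∑ i ∈ t, g i a) = ∑ i ∈ t, expect P (g i) := by
  simp only [expect, Finset.mul_sum]
  exact Summable.tsum_finsetSum fun _ _ => ENNReal.summable

end Expect

section Sample

variable {α : Type*} {p : ℝ≥0} (hp : p ≤ 1) {S : Finset α}

open scoped Classical in
theorem expect_sample (g : Finset α → ℝ≥0∞) : expect (sample p hp S) g =
    ∑ R ∈ S.powerset, (p : ℝ≥0∞) ^ R.card * (1 - (p : ℝ≥0∞)) ^ (S \ R).card * g R := by
  rw [expect, tsum_eq_sum (s := S.powerset)]
  · refine Finset.sum_congr rfl fun R hR => ?_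
    rw [sample, PMF.ofFinset_apply, if_pos (Finset.mem_powerset.mp hR)]
  · intro R hR
    rw [sample, PMF.ofFinset_apply_of_notMem _ _ hR, zero_mul]

open scoped Classical in
/-- The probability that no element of `T` is sampled. -/
theorem expect_sample_disjoint {T : Finset α} (hT : T ⊆ S) :
    expect (sample p hp S) (fun R => if Disjoint R T then 1 else 0) =
      (1 - (p : ℝ≥0∞)) ^ T.card := by
  have h : (S \ T).powerset ⊆ S.powerset := Finset.powerset_mono.mpr Finset.sdiff_subset
  rw [expect_sample, ← Finset.sum_subset h]
  -- A sample avoiding `T` is a subset of `S \ T`. Its weight is `(1 - p)^|T|` times its weight as a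
  -- sample of `S \ T`, and the latter weights sum to one.
  · refine Eq.trans ?_ ((congrArg _ (sum_sampleWeight p hp (S \ T))).trans
      (mul_one ((1 - (p : ℝ≥0∞)) ^ T.card)))
    rw [Finset.mul_sum]
    refine Finset.sum_congr rfl fun R hR => ?_
    rw [Finset.mem_powerset] at hR
    have hRT : Disjoint R T := Finset.disjoint_of_subset_left hR Finset.sdiff_disjoint
    have h1 : (S \ R).card = T.card + ((S \ T) \ R).card := by
      rw [← Finset.card_union_of_disjoint]
      · congr 1
        ext x
        have h3 := @hT x
        have h2 : x ∈ R → x ∉ T := fun h => Finset.disjoint_left.mp hRT h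
        simp only [Finset.mem_sdiff, Finset.mem_union]
        tauto
      · exact Finset.disjoint_of_subset_right Finset.sdiff_subset Finset.disjoint_sdiff
    rw [if_pos hRT, if_pos hR, h1, pow_add]
    ring
  · intro R hR hR'
    rw [if_neg, mul_zero]
    intro hRT
    exact hR' (Finset.mem_powerset.mpr (Finset.subset_sdiff.mpr ⟨Finset.mem_powerset.mp hR, hRT⟩))

theorem expect_sample_card :
    expect (sample p hp S) (fun R => (R.card : ℝ≥0∞)) = S.card * p := by
  classical
  have hp' : (p : ℝ≥0∞) ≤ 1 := by exact_mod_cast hp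
  have h1 : ∀ a ∈ S, expect (sample p hp S) (fun R => if a ∈ R then 1 else 0) = p := by
    intro a ha
    -- The complementary event is that the sample is disjoint from `{a}`.
    have h2 : expect (sample p hp S) (fun R => if a ∈ R then 1 else 0) + (1 - p) = 1 := by
      have h3 := expect_sample_disjoint hp (Finset.singleton_subset_iff.mpr ha)
      rw [Finset.card_singleton, pow_one] at h3
      rw [← h3, ← expect_add]
      refine Eq.trans (congrArg _ (funext fun R => ?_)) (expect_const (sample p hp S) 1)
      by_cases h : a ∈ R <;> simp [h]
    exact (ENNReal.add_left_inj (ENNReal.sub_ne_top ENNReal.one_ne_top)).mp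
      (h2.trans (add_tsub_cancel_of_le hp').symm)
  calc expect (sample p hp S) (fun R => (R.card : ℝ≥0∞))
      = expect (sample p hp S) (fun R => ∑ a ∈ S, if a ∈ R then 1 else 0) := by
        refine le_antisymm (expect_mono fun R hR => ?_) (expect_mono fun R hR => ?_) <;>
        · have := subset_of_mem_support_sample hR
          rw [Finset.sum_boole, Finset.filter_mem_eq_inter, Finset.inter_eq_right.mpr this]
    _ = S.card * p := by
        rw [expect_sum, Finset.sum_congr rfl h1, Finset.sum_const, nsmul_eq_mul]

end Sample

/-! ### Expected number of edges added in one epoch -/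

open scoped Classical in
-- The element of rank `j` has at least `j` keys not above its own; ties only raise the exponent.
-- Inserting elements in order of increasing key, the new one sees the whole set, and the earlier
-- exponents do not drop.
theorem sum_pow_card_le {α β : Type*} [LinearOrder β] (key : α → β) {q : ℝ≥0∞} (hq : q ≤ 1)
    (N : Finset α) :
    ∑ c ∈ N, q ^ (N.filter fun r => key r ≤ key c).card ≤
      ∑ j ∈ Finset.range N.card, q ^ (j + 1) := by
  induction N using Finset.induction_on_max_value key with
  | empty => simp
  | insert a N ha hmax ih =>
    rw [Finset.sum_insert ha, Finset.card_insert_of_notMem ha, Finset.sum_range_succ, add_comm]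
    refine add_le_add (le_trans (Finset.sum_le_sum fun c _ => ?_) ih) (le_of_eq ?_)
    · exact pow_le_pow_right_of_le_one' hq (Finset.card_le_card
        (Finset.filter_subset_filter _ (Finset.subset_insert _ _)))
    · rw [Finset.filter_true_of_mem, Finset.card_insert_of_notMem ha]
      intro r hr
      rcases Finset.mem_insert.mp hr with rfl | hr
      · exact le_rfl
      · exact hmax r hr

theorem one_add_sum_pow_le_inv {p : ℝ≥0∞} (hp : p ≤ 1) (m : ℕ) :
    1 + ∑ j ∈ Finset.range m, (1 - p) ^ (j + 1) ≤ p⁻¹ := by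
  have h := ENNReal.sum_le_tsum (f := fun j => (1 - p) ^ j) (Finset.range (m + 1))
  rw [ENNReal.tsum_geometric, ENNReal.sub_sub_cancel ENNReal.one_ne_top hp,
    Finset.sum_range_succ', pow_zero, add_comm] at h
  exact h

section Step

variable {V : Type*} {w : Sym2 V → ℝ≥0} (ch : Choice w) (s : State V)

open scoped Classical in
-- A sampled `r` at least as light as `c'` would make the merge edge at most as heavy as every edge
-- to `c'`, so apart from the closest cluster, `c'` is processed only if no such `r` is sampled.
-- This turns processing into an avoidance event of known probability.
theorem processed_subset (R : Finset (Cluster V)) (c : Cluster V) :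
    (s.clusters.filter fun c' => Processes ch s R c c') ⊆
      insert (ch.closest s.unprocessed R c)
        ((s.clusters.filter fun c' => Neighbors s.unprocessed c c').filter fun c' =>
          Disjoint R ((s.clusters.filter fun r => Neighbors s.unprocessed c r).filter fun r =>
            w (ch.lowest (edgesBetween s.unprocessed c r)) ≤
              w (ch.lowest (edgesBetween s.unprocessed c c')))) := by
  intro c' hc'
  rw [Finset.mem_filter] at hc'
  obtain ⟨hc's, h⟩ := hc'
  simp only [Finset.mem_insert, Finset.mem_filter, Finset.disjoint_left]
  rcases h with ⟨hn, rfl | ⟨f, hf, hlt⟩⟩ | ⟨hn, h⟩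
  · exact Or.inl rfl
  · refine Or.inr ⟨⟨hc's, ⟨f, hf⟩⟩, fun r hr ⟨⟨_, hrn⟩, hle⟩ => ?_⟩
    obtain ⟨e, he, hew⟩ := ch.closest_le s.unprocessed R c r hr _ (ch.lowest_mem _ hrn)
    exact absurd hlt (not_lt.mpr ((ch.lowest_le _ e he).trans
      (hew.trans (hle.trans (ch.lowest_le _ f hf)))))
  · exact Or.inr ⟨⟨hc's, h⟩, fun r hr ⟨⟨_, hrn⟩, _⟩ => hn ⟨r, hr, hrn⟩⟩

open scoped Classical in
theorem expect_card_processed_le {p : ℝ≥0} (hp : p ≤ 1) (c : Cluster V) :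
    expect (sample p hp s.clusters)
      (fun R => ((s.clusters.filter fun c' => Processes ch s R c c').card : ℝ≥0∞)) ≤
        (p : ℝ≥0∞)⁻¹ := by
  have hp' : (p : ℝ≥0∞) ≤ 1 := by exact_mod_cast hp
  set N := s.clusters.filter fun c' => Neighbors s.unprocessed c c' with hN
  set key : Cluster V → ℝ≥0 := fun r => w (ch.lowest (edgesBetween s.unprocessed c r)) with hkey
  calc _ ≤ expect (sample p hp s.clusters) (fun R => 1 + ∑ c' ∈ N,
          if Disjoint R (N.filter fun r => key r ≤ key c') then 1 else 0) := by
        refine expect_mono fun R _ => ?_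
        have h := (Finset.card_le_card
          (processed_subset ch s R c)).trans
          (Finset.card_insert_le _ _)
        rw [Finset.sum_boole, add_comm]
        exact_mod_cast h
    _ = 1 + ∑ c' ∈ N, (1 - (p : ℝ≥0∞)) ^ (N.filter fun r => key r ≤ key c').card := by
        rw [expect_add, expect_const, expect_sum]
        congr 1
        exact Finset.sum_congr rfl fun c' _ => expect_sample_disjoint hp
          ((Finset.filter_subset _ _).trans (Finset.filter_subset _ _))
    _ ≤ _ := by
        refine le_trans ?_ (one_add_sum_pow_le_inv hp' N.card)
        gcongr
        exact sum_pow_card_le key tsub_le_self N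

theorem expect_card_processedPairs_le {p : ℝ≥0} (hp : p ≤ 1) :
    expect (sample p hp s.clusters) (fun R => ((processedPairs ch s R).card : ℝ≥0∞)) ≤
      s.clusters.card * (p : ℝ≥0∞)⁻¹ := by
  classical
  calc _ ≤ expect (sample p hp s.clusters) (fun R => ∑ c ∈ s.clusters,
          ((s.clusters.filter fun c' => Processes ch s R c c').card : ℝ≥0∞)) := by
        refine expect_mono fun R _ => ?_
        -- Sampled `c` are counted as well, which avoids conditioning on `c` being unsampled.
        have h : processedPairs ch s R ⊆
            (s.clusters.sigma fun c => s.clusters.filter fun c' => Processes ch s R c c').image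
              fun q => (q.1, q.2) := by
          rintro ⟨b, c⟩ hq
          rw [mem_processedPairs] at hq
          simp only [Finset.mem_image, Finset.mem_sigma, Finset.mem_filter]
          exact ⟨⟨b, c⟩, ⟨hq.1.1.1, hq.1.2, hq.2⟩, rfl⟩
        have h' := (Finset.card_le_card h).trans Finset.card_image_le
        rw [Finset.card_sigma] at h'
        exact_mod_cast h'
    _ ≤ ∑ c ∈ s.clusters, (p : ℝ≥0∞)⁻¹ := by
        rw [expect_sum]
        exact Finset.sum_le_sum fun c _ => expect_card_processed_le ch s hp c
    _ = _ := by rw [Finset.sum_const, nsmul_eq_mul]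

theorem card_step_clusters_le (R : Finset (Cluster V)) :
    (s.step ch R).clusters.card ≤ R.card := by
  classical exact Finset.card_image_le

theorem card_step_spanner_le (R : Finset (Cluster V)) :
    (s.step ch R).spanner.card ≤ s.spanner.card + (processedPairs ch s R).card := by
  classical exact (Finset.card_union_le _ _).trans (Nat.add_le_add_left Finset.card_image_le _)

theorem card_output_le [Fintype V] :
    (s.output ch).card ≤ s.spanner.card + Fintype.card V * s.clusters.card := by
  classical
  refine (Finset.card_union_le _ _).trans (Nat.add_le_add_left ?_ _)
  refine Finset.card_image_le.trans ((Finset.card_filter_le _ _).trans ?_)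
  rw [Finset.card_product, Finset.card_univ]

end Step

/-! ### Expected size over all epochs, and the arithmetic of `k` -/

section PhaseOne

variable {V : Type*} [Fintype V] {w : Sym2 V → ℝ≥0} (G : SimpleGraph V) (ch : Choice w) (k : ℝ≥0)

/-- Even the irrelevant value of `lowest` at the empty set is a pair of vertices. This excludes `n =
0`, where the exponent laws fail. -/
theorem nonempty_of_choice {V : Type*} {w : Sym2 V → ℝ≥0} (ch : Choice w) : Nonempty V :=
  ⟨(ch.lowest ∅).out.1⟩

/-- The sampling exponents add up: `1 + 2 + ... + 2^(i-1) = 2^i - 1`. -/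
theorem expect_card_clusters_le (hV : Fintype.card V ≠ 0) (i : ℕ) :
    expect (phaseOne G ch k i) (fun s => (s.clusters.card : ℝ≥0∞)) ≤
      (((Fintype.card V : ℝ≥0) ^ (1 - ((2 : ℝ) ^ i - 1) / (k : ℝ)) : ℝ≥0) : ℝ≥0∞) := by
  induction i with
  | zero =>
    classical
    rw [phaseOne, expect_pure]
    have : (State.init G).clusters.card ≤ Fintype.card V := Finset.card_image_le
    simpa using this
  | succ i ih =>
    rw [phaseOne, expect_bind]
    simp only [expect_map]
    calc _ ≤ expect (phaseOne G ch k i) (fun s => (s.clusters.card : ℝ≥0∞) *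
            samplingProb (Fintype.card V) k (i + 1)) := by
          refine expect_mono fun s _ => ?_
          rw [← expect_sample_card (samplingProb_le_one (Fintype.card V) k (i + 1))]
          exact expect_mono fun R _ => by exact_mod_cast card_step_clusters_le ch s R
      _ ≤ _ := by
          rw [expect_mul_const]
          refine (mul_le_mul_left ih _).trans (le_of_eq ?_)
          rw [← ENNReal.coe_mul, samplingProb, ← NNReal.rpow_add (by exact_mod_cast hV)]
          congr 2
          rw [Nat.add_sub_cancel]
          ring

/-- The sampling probabilities are tuned so that clusters times `1/p` is the same in each epoch: `1
- (2^i - 1)/k + 2^i/k = 1 + 1/k`. -/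
theorem expect_card_spanner_le (hV : Fintype.card V ≠ 0) (i : ℕ) :
    expect (phaseOne G ch k i) (fun s => (s.spanner.card : ℝ≥0∞)) ≤
      i * (((Fintype.card V : ℝ≥0) ^ (1 + 1 / (k : ℝ)) : ℝ≥0) : ℝ≥0∞) := by
  induction i with
  | zero =>
    rw [phaseOne, expect_pure]
    simp [State.init]
  | succ i ih =>
    rw [phaseOne, expect_bind]
    simp only [expect_map]
    have hV' : (Fintype.card V : ℝ≥0) ≠ 0 := by exact_mod_cast hV
    calc _ ≤ expect (phaseOne G ch k i) (fun s => (s.spanner.card : ℝ≥0∞) +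
            s.clusters.card * (samplingProb (Fintype.card V) k (i + 1) : ℝ≥0∞)⁻¹) := by
          refine expect_mono fun s _ => ?_
          refine le_trans ?_ (add_le_add_right (expect_card_processedPairs_le ch s
            (samplingProb_le_one (Fintype.card V) k (i + 1))) _)
          rw [← expect_const (sample (samplingProb (Fintype.card V) k (i + 1))
            (samplingProb_le_one _ _ _) s.clusters) (s.spanner.card : ℝ≥0∞), ← expect_add]
          exact expect_mono fun R _ => by
            exact_mod_cast card_step_spanner_le ch s R
      _ ≤ _ := by
          rw [expect_add, expect_mul_const, Nat.cast_add, Nat.cast_one, add_mul, one_mul]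
          refine add_le_add ih ((mul_le_mul_left (expect_card_clusters_le G ch k hV i) _).trans
            (le_of_eq ?_))
          have hpos : samplingProb (Fintype.card V) k (i + 1) ≠ 0 := by
            rw [samplingProb]
            exact (NNReal.rpow_pos (pos_iff_ne_zero.mpr hV')).ne'
          rw [← ENNReal.coe_inv hpos, ← ENNReal.coe_mul, samplingProb, ← NNReal.rpow_neg,
            ← NNReal.rpow_add hV']
          congr 2
          rw [Nat.add_sub_cancel]
          ring

theorem le_two_pow_numEpochs {k : ℝ≥0} (hk : 2 ≤ k) : (k : ℝ) ≤ 2 ^ numEpochs k := by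
  have hk' : (2 : ℝ) ≤ k := by exact_mod_cast hk
  rw [← Real.rpow_natCast, ← Real.logb_le_iff_le_rpow (by norm_num) (by linarith)]
  exact Nat.le_ceil _

theorem one_le_logb {k : ℝ≥0} (hk : 2 ≤ k) : 1 ≤ Real.logb 2 k := by
  have hk' : (2 : ℝ) ≤ k := by exact_mod_cast hk
  rw [Real.le_logb_iff_rpow_le (by norm_num) (by linarith), Real.rpow_one]
  exact hk'

theorem numEpochs_le {k : ℝ≥0} (hk : 2 ≤ k) : (numEpochs k : ℝ) ≤ Real.logb 2 k + 1 :=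
  (Nat.ceil_lt_add_one (by linarith [one_le_logb hk])).le

theorem three_pow_numEpochs_le {k : ℝ≥0} (hk : 2 ≤ k) :
    (3 : ℝ) ^ numEpochs k ≤ 3 * (k : ℝ) ^ Real.logb 2 3 := by
  have hk' : (2 : ℝ) ≤ k := by exact_mod_cast hk
  calc (3 : ℝ) ^ numEpochs k = (3 : ℝ) ^ (numEpochs k : ℝ) := (Real.rpow_natCast _ _).symm
    _ ≤ (3 : ℝ) ^ (Real.logb 2 k + 1) :=
        Real.rpow_le_rpow_of_exponent_le (by norm_num) (numEpochs_le hk)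
    _ = 3 * (k : ℝ) ^ Real.logb 2 3 := by
        rw [Real.rpow_add (by norm_num), Real.rpow_one, mul_comm]
        congr 1
        -- Both `3^(log k)` and `k^(log 3)` equal `2^(log 3 * log k)`.
        nth_rw 1 [← Real.rpow_logb (b := 2) (x := 3) (by norm_num) (by norm_num) (by norm_num)]
        nth_rw 2 [← Real.rpow_logb (b := 2) (x := (k : ℝ)) (by norm_num) (by norm_num)
          (by linarith)]
        rw [← Real.rpow_mul (by norm_num), ← Real.rpow_mul (by norm_num), mul_comm]

theorem expectedCard_clusterMerging_le (hk : 2 ≤ k) :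
    expectedCard (clusterMerging G ch k) ≤
      (numEpochs k + 1) * (((Fintype.card V : ℝ≥0) ^ (1 + 1 / (k : ℝ)) : ℝ≥0) : ℝ≥0∞) := by
  have hV : Fintype.card V ≠ 0 := by
    have := nonempty_of_choice ch
    exact Fintype.card_ne_zero
  have hV' : (Fintype.card V : ℝ≥0) ≠ 0 := by exact_mod_cast hV
  have hk' : (2 : ℝ) ≤ k := by exact_mod_cast hk
  change expect _ _ ≤ _
  rw [clusterMerging, expect_map]
  calc _ ≤ expect (phaseOne G ch k (numEpochs k)) (fun s => (s.spanner.card : ℝ≥0∞) +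
          s.clusters.card * Fintype.card V) :=
        expect_mono fun s _ => by
          rw [mul_comm]
          exact_mod_cast card_output_le ch s
    _ ≤ _ := by
        rw [expect_add, expect_mul_const, add_mul, one_mul]
        refine add_le_add (expect_card_spanner_le G ch k hV _)
          ((mul_le_mul_left (expect_card_clusters_le G ch k hV _) _).trans ?_)
        have h1 : (Fintype.card V : ℝ≥0∞) = (((Fintype.card V : ℝ≥0) ^ (1 : ℝ) : ℝ≥0) : ℝ≥0∞) := by
          simp
        rw [h1, ← ENNReal.coe_mul, ← NNReal.rpow_add hV', ENNReal.coe_le_coe]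
        refine NNReal.rpow_le_rpow_of_exponent_le
          (by exact_mod_cast Nat.one_le_iff_ne_zero.mpr hV) ?_
        -- The exponent is `2 - (2^L - 1)/k` with `L` epochs, and `2^L ≥ k` brings it down to `1 +
        -- 1/k`.
        have h2 : ((k : ℝ) - 1) / k ≤ ((2 : ℝ) ^ numEpochs k - 1) / k := by
          gcongr
          exact le_two_pow_numEpochs hk
        rw [sub_div, div_self (by linarith)] at h2
        linarith

end PhaseOne

end ClusterMerging

theorem mainTheorem4 :
    ∃ C : ℝ, 0 < C ∧
      ∀ (V : Type*) [Fintype V] (G : SimpleGraph V) (w : Sym2 V → ℝ≥0)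
        (ch : ClusterMerging.Choice w) (k : ℝ≥0), 2 ≤ k →
        -- the algorithm performs `O(log k)` epochs
        (ClusterMerging.numEpochs k : ℝ) ≤ C * Real.logb 2 k ∧
        -- after epoch `i`, the clusters have weighted-stretch radius at most `(3 ^ i - 1) / 2`
        (∀ i : ℕ, i ≤ ClusterMerging.numEpochs k →
          ∀ s ∈ (ClusterMerging.phaseOne G ch k i).support,
            ClusterMerging.HasWeightedStretchRadius G w s.clusters s.unprocessed
              (((3 : ℝ) ^ i - 1) / 2)) ∧
        -- the output is always a spanner of stretch `O(k ^ (log 3))`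
        (∀ F ∈ (ClusterMerging.clusterMerging G ch k).support,
          (F : Set (Sym2 V)) ⊆ G.edgeSet ∧
          ClusterMerging.IsSpanner G w (SimpleGraph.fromEdgeSet (F : Set (Sym2 V)))
            (ENNReal.ofReal (C * (k : ℝ) ^ Real.logb 2 3))) ∧
        -- and it has expected size `O(n ^ (1 + 1 / k) * log k)`
        ClusterMerging.expectedCard (ClusterMerging.clusterMerging G ch k) ≤
          ENNReal.ofReal
            (C * (Fintype.card V : ℝ) ^ (1 + 1 / (k : ℝ)) * Real.logb 2 k) := by
  -- The stretch decides the constant: `2 * 3^L ≤ 6 * k^(log 3)`. As `log k ≥ 1`, the epochs need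
  -- only `2` and the size, through `L + 1 ≤ log k + 2`, only `3`.
  refine ⟨6, by norm_num, fun V _ G w ch k hk => ?_⟩
  have hlog := ClusterMerging.one_le_logb hk
  have hnum := ClusterMerging.numEpochs_le hk
  have hthree := ClusterMerging.three_pow_numEpochs_le hk
  have hk' : (2 : ℝ) ≤ k := by exact_mod_cast hk
  refine ⟨by linarith, fun i _ s hs => ?_, fun F hF => ?_, ?_⟩
  · obtain ⟨r, hr, inv⟩ := ClusterMerging.exists_invariant ch k i s hs
    have h : ((3 : ℝ) ^ i - 1) / 2 = r := by
      have : (2 * r + 1 : ℝ) = 3 ^ i := by exact_mod_cast hr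
      linarith
    rw [h]
    exact inv.hasWeightedStretchRadius
  · rw [ClusterMerging.clusterMerging, PMF.mem_support_map_iff] at hF
    obtain ⟨s, hs, rfl⟩ := hF
    obtain ⟨r, hr, inv⟩ := ClusterMerging.exists_invariant ch k _ s hs
    have hsub : (s.output ch : Set (Sym2 V)) ⊆ G.edgeSet := inv.output_subset ch
    refine ⟨hsub, ClusterMerging.isSpanner_of_within ?_ (n := 2 * 3 ^ ClusterMerging.numEpochs k) ?_
      ?_ ENNReal.ofReal_ne_top fun x y hxy => inv.within_output ch le_rfl (by omega) hxy⟩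
    · rw [← SimpleGraph.fromEdgeSet_edgeSet G]
      exact SimpleGraph.fromEdgeSet_mono hsub
    · rw [← ENNReal.ofReal_natCast]
      refine ENNReal.ofReal_le_ofReal ?_
      push_cast
      linarith
    · rw [Ne, ENNReal.ofReal_eq_zero, not_le]
      have : (0 : ℝ) < (k : ℝ) ^ Real.logb 2 3 := Real.rpow_pos_of_pos (by linarith) _
      positivity
  · refine (ClusterMerging.expectedCard_clusterMerging_le G ch k hk).trans ?_
    have h : ((ClusterMerging.numEpochs k : ℝ≥0∞) + 1) *
        (((Fintype.card V : ℝ≥0) ^ (1 + 1 / (k : ℝ)) : ℝ≥0) : ℝ≥0∞) =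
        ENNReal.ofReal ((ClusterMerging.numEpochs k + 1) *
          (Fintype.card V : ℝ) ^ (1 + 1 / (k : ℝ))) := by
      rw [ENNReal.ofReal_mul (by positivity), ENNReal.ofReal_add (by positivity) zero_le_one,
        ENNReal.ofReal_natCast, ENNReal.ofReal_one, ← ENNReal.ofReal_coe_nnreal]
      simp
    rw [h]
    refine ENNReal.ofReal_le_ofReal ?_
    have h0 : (0 : ℝ) ≤ (Fintype.card V : ℝ) ^ (1 + 1 / (k : ℝ)) := by positivity
    nlinarith
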